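/- Let $(R,\mathfrak m)$ be a Noetherian local ring of dimension $d\ge 1$ with infinite residue field, let $s\ge 1$, and let $I_1,\dots,I_s$ be $\mathfrak m$-primary ideals of $R$. For $\mathbf n\in\mathbb Z^s$ put $\mathbf I^{\mathbf n}=I_1^{n_1}\cdots I_s^{n_s}$ (with $I_j^{k}=R$ for $k\le 0$), and let $\mathbf e=(1,\dots,1)$ and $\mathbf e_1,\dots,\mathbf e_s$ be the standard basis vectors of $\mathbb Z^s$; $\mathbb Z^s$ is ordered componentwise. Let $\mathcal F=\{\mathcal F(\mathbf n)\}_{\mathbf n\in\mathbb Z^s}$ be an $\mathbf I$-admissible filtration, i.e. a family of ideals of $R$ such that for all $\mathbf m,\mathbf n\in\mathbb Z^s$: $\mathbf I^{\mathbf n}\subseteq\mathcal F(\mathbf n)$; $\mathcal F(\mathbf n)\mathcal F(\mathbf m)\subseteq\mathcal F(\mathbf n+\mathbf m)$; $\mathcal F(\mathbf m)\subseteq\mathcal F(\mathbf n)$ whenever $\mathbf m\ge\mathbf n$; $\mathcal F(\mathbf n)=\mathcal F(\mathbf n^+)$, where $\mathbf n^+=(\max\{0,n_1\},\dots,\max\{0,n_s\})$;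 and the extended Rees ring $\bigoplus_{\mathbf n\in\mathbb Z^s}\mathcal F(\mathbf n)\mathbf t^{\mathbf n}$ is a finite module over $\bigoplus_{\mathbf n\in\mathbb Z^s}\mathbf I^{\mathbf n}\mathbf t^{\mathbf n}$. Let $G(\mathcal F)=\bigoplus_{\mathbf n\in\mathbb N^s}\mathcal F(\mathbf n)/\mathcal F(\mathbf n+\mathbf e)$ and $G(\mathbf I)=\bigoplus_{\mathbf n\in\mathbb N^s}\mathbf I^{\mathbf n}/\mathbf I^{\mathbf n+\mathbf e}$, and regard $G(\mathcal F)$ as a $\mathbb Z^s$-graded $G(\mathbf I)$-module. Let $G(\mathbf I)_{++}=\bigoplus_{\mathbf n\ge\mathbf e}G(\mathbf I)_{\mathbf n}$. Let $\operatorname{reg}(G(\mathcal F))$ be the set of all $\mathbf m\in\mathbb Z^s$ such that for all $\mathbf n\in\mathbb N^s$: 1. $[H^0_{G(\mathbf I)_{++}}(G(\mathcal F))]_{\mathbf n+\mathbf m+\mathbf e_j}=0$ for all $j=1,\dots,s$; 2. $[H^i_{G(\mathbf I)_{++}}(G(\mathcal F))]_{\mathbf n+\mathbf m-\mathbf p}=0$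 for all $i\ge 1$ and all $\mathbf p=(p_1,\dots,p_s)\in\mathbb N^s$ with $p_1+\cdots+p_s=i-1$. Then $\operatorname{reg}(G(\mathcal F))\subseteq\mathbb N^s$. -/

import Mathlib

namespace MultigradedRegularity

noncomputable section

/-! ### Multigraded local cohomology through the Čech complex -/

section Cech

variable {A M : Type*} [CommRing A] [AddCommGroup M] [Module A M] {r : ℕ} (f : Fin r → A)

/-- The multiplicative set generated by `f (σ 0), …, f (σ (i - 1))`, for indices
`σ 0 < ⋯ < σ (i - 1)`. -/
def cechMonoid {i : ℕ} (σ : Fin i ↪o Fin r) : Submonoid A :=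
  Submonoid.closure (Set.range fun k => f (σ k))

/-- The indices `σ 0 < ⋯ < σ i` with the `k`-th one omitted. -/
def omitIndex {i : ℕ} (σ : Fin (i + 1) ↪o Fin r) (k : Fin (i + 1)) : Fin i ↪o Fin r :=
  (Fin.succAboveOrderEmb k).trans σ

theorem cechMonoid_omitIndex_le {i : ℕ} (σ : Fin (i + 1) ↪o Fin r) (k : Fin (i + 1)) :
    cechMonoid f (omitIndex σ k) ≤ cechMonoid f σ := by
  apply Submonoid.closure_mono
  rintro _ ⟨j, rfl⟩
  exact ⟨k.succAbove j, rfl⟩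

variable (M) in
/-- The `i`-th term of the Čech complex of `M` on the elements `f 0, …, f (r - 1)`: the product over
all `σ 0 < ⋯ < σ (i - 1)` of the localization of `M` at `f (σ 0), …, f (σ (i - 1))`. -/
abbrev CechCochain (i : ℕ) : Type _ :=
  (σ : Fin i ↪o Fin r) → LocalizedModule (cechMonoid f σ) M

variable (M) in
/-- The Čech differential, `(d c) σ = ∑ k, (-1) ^ k • c (σ 0, …, omitting σ k, …, σ i)`. -/
def cechD (i : ℕ) : CechCochain M f i →ₗ[A] CechCochain M f (i + 1) :=
  LinearMap.pi fun σ => ∑ k : Fin (i + 1), (-1 : ℤ) ^ (k : ℕ) •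
    (LocalizedModule.liftOfLE (cechMonoid f (omitIndex σ k)) (cechMonoid f σ)
      (cechMonoid_omitIndex_le f σ k)).comp (LinearMap.proj (omitIndex σ k))

variable (M) in
/-- Čech `i`-cocycles. -/
def cechCocycles (i : ℕ) : Submodule A (CechCochain M f i) :=
  LinearMap.ker (cechD M f i)

variable (M) in
/-- Čech `i`-coboundaries. -/
def cechCoboundaries : (i : ℕ) → Submodule A (CechCochain M f i)
  | 0 => ⊥
  | i + 1 => LinearMap.range (cechD M f i)

variable (M) in
/-- The `i`-th Čech cohomology of `M` on `f 0, …, f (r - 1)`. For Noetherian `A` this is the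
local cohomology module `H^i_J(M)`, where `J` is the ideal generated by the `f j`. -/
abbrev CechCohomology (i : ℕ) : Type _ :=
  cechCocycles M f i ⧸ (cechCoboundaries M f i).submoduleOf (cechCocycles M f i)

variable {R : Type*} [CommRing R] [Algebra R A] [Module R M] {s : ℕ}

/-- The degree `n` elements of the localization of a graded module `(M, ℳ)` over a graded ring
`(A, 𝒜)` at a multiplicative set `S`: the fractions `x / a` with `x` homogeneous, `a ∈ S`
homogeneous and `deg x - deg a = n`. -/
def localizedPiece (𝒜 : (Fin s → ℤ) → Submodule R A) (ℳ : (Fin s → ℤ) → Submodule R M)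
    (S : Submonoid A) (n : Fin s → ℤ) : Set (LocalizedModule S M) :=
  {z | ∃ (a : S) (b : Fin s → ℤ) (x : M),
    (a : A) ∈ 𝒜 b ∧ x ∈ ℳ (b + n) ∧ z = LocalizedModule.mk x a}

/-- The degree `n` elements of the `i`-th Čech cohomology: the classes of the cocycles all of whose
components have degree `n`. -/
def cohomologyPiece (𝒜 : (Fin s → ℤ) → Submodule R A) (ℳ : (Fin s → ℤ) → Submodule R M)
    (i : ℕ) (n : Fin s → ℤ) : Set (CechCohomology M f i) :=
  {h | ∃ c : cechCocycles M f i,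
    (∀ σ, c.1 σ ∈ localizedPiece 𝒜 ℳ (cechMonoid f σ) n) ∧ Submodule.Quotient.mk c = h}

/-- The ideal `A₊₊ = ⨁_{n ≥ e} A_n` of an `ℕ^s`-graded ring, where `e = (1, …, 1)`. -/
def irrelevantIdeal (𝒜 : (Fin s → ℤ) → Submodule R A) : Ideal A :=
  Ideal.span {x | ∃ n : Fin s → ℤ, 1 ≤ n ∧ x ∈ 𝒜 n}

/-- `f` is a finite system of homogeneous generators of the ideal `A₊₊`. -/
def IsHomogeneousGenerators (𝒜 : (Fin s → ℤ) → Submodule R A) : Prop :=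
  (∀ j, ∃ n, f j ∈ 𝒜 n) ∧ Ideal.span (Set.range f) = irrelevantIdeal 𝒜

/-- The graded module `(M, ℳ)` over the (Noetherian) `ℕ^s`-graded ring `(A, 𝒜)` is `m`-regular:
for all `n ∈ ℕ^s`,
* `[H^0_{A₊₊}(M)]_{n + m + e_j} = 0` for all `j`;
* `[H^i_{A₊₊}(M)]_{n + m - p} = 0` for all `i ≥ 1` and `p ∈ ℕ^s` with `|p| = i - 1`.

The local cohomology is computed by the Čech complex on some finite system of homogeneous generators
of `A₊₊`; up to isomorphism of graded modules it does not depend on that system. -/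
def IsRegularVector (𝒜 : (Fin s → ℤ) → Submodule R A) (ℳ : (Fin s → ℤ) → Submodule R M)
    (m : Fin s → ℤ) : Prop :=
  ∃ (r : ℕ) (f : Fin r → A), IsHomogeneousGenerators f 𝒜 ∧
    (∀ (n : Fin s → ℕ) (j : Fin s),
      cohomologyPiece f 𝒜 ℳ 0 ((fun l => (n l : ℤ)) + m + Pi.single j 1) ⊆ {0}) ∧
    (∀ (n : Fin s → ℕ) (i : ℕ) (p : Fin s → ℕ), 1 ≤ i → ∑ l, p l = i - 1 →
      cohomologyPiece f 𝒜 ℳ i ((fun l => (n l : ℤ)) + m - fun l => (p l : ℤ)) ⊆ {0})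

end Cech

/-! ### Filtrations and blowup algebras -/

variable {R : Type*} [CommRing R] {s : ℕ}

/-- `I^n = I_1^{n_1} ⋯ I_s^{n_s}` for `n ∈ ℤ^s`, with the convention `I_j^k = R` for `k ≤ 0`. -/
def idealPow (I : Fin s → Ideal R) (n : Fin s → ℤ) : Ideal R :=
  ∏ j, I j ^ (n j).toNat

/-- `ℤ^s`-graded `I`-filtrations of ideals. -/
structure MultiFiltration (I : Fin s → Ideal R) where
  /-- the ideal `F(n)` -/
  ideal : (Fin s → ℤ) → Ideal R
  idealPow_le : ∀ n, idealPow I n ≤ ideal n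
  mul_le : ∀ n m, ideal n * ideal m ≤ ideal (n + m)
  anti : ∀ n m, n ≤ m → ideal m ≤ ideal n

theorem idealPow_zero (I : Fin s → Ideal R) : idealPow I 0 = 1 := by
  simp [idealPow]

theorem idealPow_anti (I : Fin s → Ideal R) (n m : Fin s → ℤ) (h : n ≤ m) :
    idealPow I m ≤ idealPow I n :=
  Finset.prod_le_prod' fun j _ => Ideal.pow_le_pow_right (Int.toNat_le_toNat (h j))

theorem idealPow_mul_le (I : Fin s → Ideal R) (n m : Fin s → ℤ) :
    idealPow I n * idealPow I m ≤ idealPow I (n + m) := by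
  rw [idealPow, idealPow, ← Finset.prod_mul_distrib]
  refine Finset.prod_le_prod' fun j _ => ?_
  rw [← pow_add]
  refine Ideal.pow_le_pow_right ?_
  simp only [Pi.add_apply]
  omega

/-- The filtration `{I^n}`. -/
def adic (I : Fin s → Ideal R) : MultiFiltration I where
  ideal := idealPow I
  idealPow_le _ := le_rfl
  mul_le := idealPow_mul_le I
  anti := idealPow_anti I

/-- The subalgebra `⨁ N(n) t^n` of the Laurent polynomial ring `R[t_1^{±1}, …, t_s^{±1}]`, for a
multiplicative family `N` of ideals. -/
def coeffSubalgebra (N : (Fin s → ℤ) → Ideal R) (h0 : N 0 = ⊤)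
    (hmul : ∀ n m, N n * N m ≤ N (n + m)) : Subalgebra R (AddMonoidAlgebra R (Fin s → ℤ)) where
  carrier := {x | ∀ n, x.coeff n ∈ N n}
  mul_mem' {x y} hx hy n := by
    classical
    rw [AddMonoidAlgebra.coeff_mul]
    refine Ideal.sum_mem _ fun a _ => Ideal.sum_mem _ fun b _ => ?_
    dsimp only
    split_ifs with h
    · rw [← h]
      exact hmul a b (Ideal.mul_mem_mul (hx a) (hy b))
    · exact Ideal.zero_mem _
  add_mem' {x y} hx hy n := Ideal.add_mem _ (hx n) (hy n)
  algebraMap_mem' a n := by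
    classical
    simp only [AddMonoidAlgebra.coe_algebraMap, Function.comp_apply,
      AddMonoidAlgebra.coeff_single, Finsupp.single_apply]
    split_ifs with h
    · rw [← h, h0]
      trivial
    · exact Ideal.zero_mem _

namespace MultiFiltration

variable {I : Fin s → Ideal R} (F : MultiFiltration I)

theorem ideal_zero : F.ideal 0 = ⊤ := by
  have h := F.idealPow_le 0
  rw [idealPow_zero, Ideal.one_eq_top] at h
  exact top_le_iff.mp h

/-- The extended Rees ring `R'(F) = ⨁_{n ∈ ℤ^s} F(n) t^n`. -/
def extRees : Subalgebra R (AddMonoidAlgebra R (Fin s → ℤ)) :=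
  coeffSubalgebra F.ideal F.ideal_zero F.mul_le

open Classical in
/-- `F(n)` for `n ∈ ℕ^s`, and `0` for all other `n`. -/
def nonnegIdeal (n : Fin s → ℤ) : Ideal R := if 0 ≤ n then F.ideal n else ⊥

theorem nonnegIdeal_le (n : Fin s → ℤ) : F.nonnegIdeal n ≤ F.ideal n := by
  unfold nonnegIdeal
  split_ifs
  · exact le_rfl
  · exact bot_le

theorem nonnegIdeal_mul_le (n m : Fin s → ℤ) :
    F.nonnegIdeal n * F.nonnegIdeal m ≤ F.nonnegIdeal (n + m) := by
  by_cases hn : 0 ≤ n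
  · by_cases hm : 0 ≤ m
    · simpa only [nonnegIdeal, if_pos hn, if_pos hm, if_pos (add_nonneg hn hm)] using F.mul_le n m
    · simp [nonnegIdeal, if_neg hm]
  · simp [nonnegIdeal, if_neg hn]

/-- The Rees ring `R(F) = ⨁_{n ∈ ℕ^s} F(n) t^n`. -/
def rees : Subalgebra R (AddMonoidAlgebra R (Fin s → ℤ)) :=
  coeffSubalgebra F.nonnegIdeal (by simpa [nonnegIdeal] using F.ideal_zero) F.nonnegIdeal_mul_le

/-- The ideal `⨁_{n ∈ ℕ^s} F(n + e) t^n` of `R(F)`, where `e = (1, …, 1)`. -/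
def reesShift : Ideal F.rees where
  carrier := {x | ∀ n, x.1.coeff n ∈ F.ideal (n + 1)}
  zero_mem' _ := Ideal.zero_mem _
  add_mem' {x y} hx hy n := Ideal.add_mem _ (hx n) (hy n)
  smul_mem' a x hx n := by
    classical
    change (a.1 * x.1).coeff n ∈ _
    rw [AddMonoidAlgebra.coeff_mul]
    refine Ideal.sum_mem _ fun b _ => Ideal.sum_mem _ fun c _ => ?_
    dsimp only
    split_ifs with h
    · rw [← h, add_assoc]
      exact F.mul_le b (c + 1) (Ideal.mul_mem_mul (F.nonnegIdeal_le b (a.2 b)) (hx c))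
    · exact Ideal.zero_mem _

/-- The associated multigraded ring `G(F) = ⨁_{n ∈ ℕ^s} F(n) / F(n + e)`. -/
def assocRing : Type _ := F.rees ⧸ F.reesShift

instance : CommRing F.assocRing := inferInstanceAs (CommRing (F.rees ⧸ F.reesShift))

instance : Algebra R F.assocRing := inferInstanceAs (Algebra R (F.rees ⧸ F.reesShift))

/-- The projection `R(F) → G(F)`. -/
def assocMk : F.rees →ₐ[R] F.assocRing := Ideal.Quotient.mkₐ R F.reesShift

/-- The degree `n` component of `G(F)`, for `n ∈ ℤ^s`: the classes of the elements `a t^n` of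
`R(F)`. It is `F(n) / F(n + e)` for `n ∈ ℕ^s`, and `0` otherwise. -/
def assocPiece (n : Fin s → ℤ) : Submodule R F.assocRing :=
  Submodule.map F.assocMk.toLinearMap
    { carrier := {x : F.rees | ∀ k, k ≠ n → x.1.coeff k = 0}
      zero_mem' := fun _ _ => rfl
      add_mem' := fun {x y} hx hy k hk => by
        change x.1.coeff k + y.1.coeff k = 0
        rw [hx k hk, hy k hk, add_zero]
      smul_mem' := fun a x hx k hk => by
        change a • x.1.coeff k = 0
        rw [hx k hk, smul_zero] }

theorem adic_extRees_le : (adic I).extRees ≤ F.extRees :=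
  fun _ hx n => F.idealPow_le n (hx n)

theorem adic_rees_le : (adic I).rees ≤ F.rees := by
  intro x hx n
  have h : x.coeff n ∈ (adic I).nonnegIdeal n := hx n
  change x.coeff n ∈ F.nonnegIdeal n
  unfold nonnegIdeal at h ⊢
  split_ifs at h ⊢
  · exact F.idealPow_le n h
  · exact h

/-- The filtration is `I`-admissible: `F(n) = F(n⁺)` for all `n`, and `R'(F)` is a finite
`R'(I)`-module. -/
def IsAdmissible : Prop :=
  (∀ n : Fin s → ℤ, F.ideal n = F.ideal fun j => max 0 (n j)) ∧
    (Subalgebra.inclusion F.adic_extRees_le).Finite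

/-- The canonical homomorphism `G(I) → G(F)`, induced by the inclusion of `R(I)` in `R(F)`. -/
def assocMap : (adic I).assocRing →+* F.assocRing :=
  Ideal.quotientMap F.reesShift (Subalgebra.inclusion F.adic_rees_le).toRingHom
    (fun _ hx n => F.idealPow_le (n + 1) (hx n))

/-- `reg(G(F))`: the set of all `m ∈ ℤ^s` such that `G(F)` is `m`-regular as a multigraded
`G(I)`-module. -/
def regAssoc : Set (Fin s → ℤ) :=
  letI : Module (adic I).assocRing F.assocRing := F.assocMap.toModule
  {m | IsRegularVector (adic I).assocPiece F.assocPiece m}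

end MultiFiltration

end

end MultigradedRegularity

/-! Suppose `m` is a regular vector with `m j < 0`. As in Castelnuovo–Mumford theory, regularity
forces generation in the direction `e_j`: for `k ≥ m`, the piece of `G(F)` in degree `k + e_j` is
spanned by the products of `G(I)_{e_j}` with `G(F)_k` (`exists_eq_sum_smul`). Since `G(F)` is zero
where the `j`-th coordinate is negative, climbing along `e_j` from there shows that `G(F)_k = 0` for
all `k ≥ m`. Hence `F(N) = F(N + e) = F(N + 2e) = ⋯` for `N = m⁺`. Admissibility gives `F(n) ⊆ I^{n
- c}` for a fixed `c`, so Krull's intersection theorem yields `F(N) = 0`. Then `I^N = 0`, and as the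
`I_i` are `𝔪`-primary the dimension is at most zero, a contradiction.

Generation comes from a double complex: Čech cochains in one direction, a Koszul-like complex on
generators `y` of `I_j`, placed in degree `e_j`, in the other. The Koszul direction is exact on Čech
cochains of positive index, because there some element of `A₊₊`, a combination of the `y l`, is
invertible. The Čech direction is exact in the degrees needed, by regularity. Chains indexed by
arbitrary lists replace exterior powers: the contracting homotopy then just prepends an entry.

Homogeneity is handled by pairing each piece `ℳ n` with a complement `ℳ' n` that homogeneous
multiplication respects. -/

namespace MultigradedRegularity

noncomputable section

/-! ### A Koszul complex on tensor powers -/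

section ListKoszul

variable {A N N' L : Type*} [CommRing A] [AddCommGroup N] [Module A N] [AddCommGroup N']
  [Module A N'] [Fintype L] (y : L → A)

/-- The Koszul-like differential on the complex whose `p`-chains are the functions on the lists of
length `p`: the alternating sum of the contractions of the entries of the list against `y`. -/
def listKoszulD : List L → (List L → N) → N
  | [], c => ∑ l, y l • c [l]
  | l :: τ, c => ∑ l', y l' • c (l' :: l :: τ) - listKoszulD τ fun τ' => c (l :: τ')

theorem listKoszulD_congr (τ : List L) {c c' : List L → N}
    (h : ∀ τ', τ'.length = τ.length + 1 → c τ' = c' τ') :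
    listKoszulD y τ c = listKoszulD y τ c' := by
  induction τ generalizing c c' with
  | nil => exact Finset.sum_congr rfl fun l _ => by rw [h [l] rfl]
  | cons l τ ih =>
    simp only [listKoszulD]
    rw [ih fun τ' hτ' => h (l :: τ') (by simp [hτ'])]
    congr 1
    exact Finset.sum_congr rfl fun l' _ => by rw [h _ rfl]

theorem listKoszulD_sub (τ : List L) (c c' : List L → N) :
    listKoszulD y τ (fun τ' => c τ' - c' τ') = listKoszulD y τ c - listKoszulD y τ c' := by
  induction τ generalizing c c' with
  | nil => simp [listKoszulD, smul_sub]
  | cons l τ ih =>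
    simp only [listKoszulD, ih, smul_sub, Finset.sum_sub_distrib]
    abel

theorem sum_smul_sum_smul_comm {L' : Type*} [Fintype L'] (z : L' → A) (c : L → L' → N) :
    ∑ l, ∑ l', y l • z l' • c l l' = ∑ l', ∑ l, z l' • y l • c l l' := by
  rw [Finset.sum_comm]
  exact Finset.sum_congr rfl fun _ _ => Finset.sum_congr rfl fun _ _ => smul_comm _ _ _

theorem listKoszulD_sum_smul (τ : List L) (c : L → List L → N) :
    listKoszulD y τ (fun τ' => ∑ l, y l • c l τ') = ∑ l, y l • listKoszulD y τ (c l) := by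
  induction τ generalizing c with
  | nil =>
    simp only [listKoszulD, Finset.smul_sum]
    exact sum_smul_sum_smul_comm y y fun l' l => c l [l']
  | cons l τ ih =>
    simp only [listKoszulD, ih, smul_sub, Finset.sum_sub_distrib, Finset.smul_sum]
    rw [sum_smul_sum_smul_comm y y fun l'' l' => c l' (l'' :: l :: τ)]

theorem map_listKoszulD (g : N →ₗ[A] N') (τ : List L) (c : List L → N) :
    g (listKoszulD y τ c) = listKoszulD y τ fun τ' => g (c τ') := by
  induction τ generalizing c with
  | nil => simp [listKoszulD]
  | cons l τ ih => simp [listKoszulD, ih]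

/-- The two orders of contracting the same pair of entries carry opposite signs, and the scalars `y
l`, `y l'` commute. -/
theorem listKoszulD_listKoszulD (τ : List L) (c : List L → N) :
    listKoszulD y τ (fun τ' => listKoszulD y τ' c) = 0 := by
  induction τ generalizing c with
  | nil =>
    simp only [listKoszulD, smul_sub, Finset.sum_sub_distrib, Finset.smul_sum]
    rw [sub_eq_zero]
    exact sum_smul_sum_smul_comm y y fun l l' => c [l', l]
  | cons l τ ih =>
    simp only [listKoszulD, listKoszulD_sub, ih, smul_sub, Finset.sum_sub_distrib,
      Finset.smul_sum, listKoszulD_sum_smul, sub_zero]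
    rw [sum_smul_sum_smul_comm y y fun l' l'' => c (l'' :: l' :: l :: τ)]
    abel

theorem listKoszulD_mem {ι : Type*} [AddCommGroup ι] (P : ι → AddSubgroup N) (e : ι)
    (hP : ∀ l n x, x ∈ P n → y l • x ∈ P (n + e)) (τ : List L) (n : ι) (c : List L → N)
    (hc : ∀ τ', τ'.length = τ.length + 1 → c τ' ∈ P n) : listKoszulD y τ c ∈ P (n + e) := by
  induction τ generalizing c with
  | nil => exact sum_mem fun l _ => hP _ _ _ (hc _ rfl)
  | cons l τ ih =>
    refine sub_mem (sum_mem fun l _ => hP _ _ _ (hc _ rfl)) (ih _ fun τ' hτ' => hc _ ?_)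
    simp [hτ']

/-- The contracting homotopy of `listKoszulD` attached to a family of endomorphisms. -/
def listKoszulH (g : L → N →ₗ[A] N) (c : List L → N) : List L → N
  | [] => 0
  | l :: τ => g l (c τ)

/-- Contracting the prepended entry returns `c τ` by `hg`; all other contractions commute with the
linear maps `g l`. -/
theorem listKoszulD_listKoszulH (g : L → N →ₗ[A] N) (hg : ∀ x, ∑ l, y l • g l x = x)
    (τ : List L) (c : List L → N) :
    listKoszulD y τ (listKoszulH g c) =
      c τ - listKoszulH g (fun τ' => listKoszulD y τ' c) τ := by
  cases τ with
  | nil => simp [listKoszulD, listKoszulH, hg]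
  | cons l τ => simp [listKoszulD, listKoszulH, hg, map_listKoszulD]

end ListKoszul

/-! ### The Čech complex -/

theorem sum_alternating_eq_zero {X : Type*} [AddCommGroup X] {n : ℕ}
    (G : Fin (n + 2) → Fin (n + 1) → X) (hG : ∀ i j : Fin (n + 1), i ≤ j →
      G j.succ i = G i.castSucc j) :
    ∑ k : Fin (n + 2), (-1 : ℤ) ^ (k : ℕ) • ∑ l : Fin (n + 1), (-1 : ℤ) ^ (l : ℕ) • G k l = 0 := by
  simp only [Finset.smul_sum, smul_smul]
  rw [← Fintype.sum_prod_type' (f := fun (k : Fin (n + 2)) (l : Fin (n + 1)) =>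
    ((-1 : ℤ) ^ (k : ℕ) * (-1) ^ (l : ℕ)) • G k l)]
  rw [← Finset.sum_filter_add_sum_filter_not _ (fun x : Fin (n + 2) × Fin (n + 1) =>
    x.2.castSucc < x.1)]
  rw [add_eq_zero_iff_eq_neg, ← Finset.sum_neg_distrib]
  -- Terms cancel in pairs: `(k, l)` with `l < k` is matched with `(l, k - 1)`, which has the
  -- opposite sign.
  refine Finset.sum_bij' (fun x hx => (x.2.castSucc, x.1.pred ?_))
    (fun x hx => (x.2.succ, x.1.castPred ?_)) ?_ ?_ ?_ ?_ ?_
  · intro h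
    simp [h] at hx
  · intro h
    simp only [Finset.mem_filter, Finset.mem_univ, true_and, h] at hx
    exact hx (Fin.castSucc_lt_last _)
  · rintro ⟨k, l⟩ hx
    simp only [Finset.mem_filter, Finset.mem_univ, true_and, Fin.lt_def,
      Fin.val_castSucc, Fin.val_pred] at hx ⊢
    omega
  · rintro ⟨k, l⟩ hx
    simp only [Finset.mem_filter, Finset.mem_univ, true_and, Fin.lt_def,
      Fin.val_castSucc, Fin.coe_castPred, Fin.val_succ] at hx ⊢
    omega
  · rintro ⟨k, l⟩ hx
    simp
  · rintro ⟨k, l⟩ hx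
    simp
  · rintro ⟨k, l⟩ hx
    simp only [Finset.mem_filter, Finset.mem_univ, true_and, Fin.lt_def,
      Fin.val_castSucc] at hx ⊢
    obtain ⟨j, rfl⟩ := Fin.exists_succ_eq_of_ne_zero (x := k) (by rintro rfl; simp at hx)
    rw [Fin.val_succ] at hx
    rw [hG l j (by rw [Fin.le_def]; omega), ← neg_smul]
    simp only [Fin.val_succ, Fin.pred_succ, pow_succ]
    congr 1
    ring

section Cech

variable {A M : Type*} [CommRing A] [AddCommGroup M] [Module A M] {r : ℕ} (f : Fin r → A)

theorem liftOfLE_mk {S T : Submonoid A} (h : S ≤ T) (x : M) (a : S) :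
    LocalizedModule.liftOfLE S T h (LocalizedModule.mk x a) =
      LocalizedModule.mk x (⟨a, h a.2⟩ : T) := by
  have := IsLocalizedModule.liftOfLE_mk' S T h (LocalizedModule.mkLinearMap S M)
    (LocalizedModule.mkLinearMap T M) x a
  simpa only [← IsLocalizedModule.mk_eq_mk'] using this

theorem cechD_apply (i : ℕ) (c : CechCochain M f i) (σ : Fin (i + 1) ↪o Fin r) :
    cechD M f i c σ = ∑ k : Fin (i + 1), (-1 : ℤ) ^ (k : ℕ) •
      LocalizedModule.liftOfLE (cechMonoid f (omitIndex σ k)) (cechMonoid f σ)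
        (cechMonoid_omitIndex_le f σ k) (c (omitIndex σ k)) := by
  simp only [cechD, LinearMap.pi_apply, LinearMap.sum_apply]
  exact Finset.sum_congr rfl fun k _ => rfl

theorem liftOfLE_liftOfLE {S T U : Submonoid A} (h : S ≤ T) (h' : T ≤ U)
    (z : LocalizedModule S M) :
    LocalizedModule.liftOfLE T U h' (LocalizedModule.liftOfLE S T h z) =
      LocalizedModule.liftOfLE S U (h.trans h') z := by
  induction z with | _ x a => simp only [liftOfLE_mk]

theorem liftOfLE_congr {i : ℕ} (c : CechCochain M f i) {T : Submonoid A}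
    {σ σ' : Fin i ↪o Fin r} (h : σ = σ') (hσ : cechMonoid f σ ≤ T) (hσ' : cechMonoid f σ' ≤ T) :
    LocalizedModule.liftOfLE (cechMonoid f σ) T hσ (c σ) =
      LocalizedModule.liftOfLE (cechMonoid f σ') T hσ' (c σ') := by
  subst h
  rfl

/-- The simplicial identity behind `d ∘ d = 0`. -/
theorem omitIndex_omitIndex {i : ℕ} (σ : Fin (i + 2) ↪o Fin r) {k l : Fin (i + 1)} (h : k ≤ l) :
    omitIndex (omitIndex σ l.succ) k = omitIndex (omitIndex σ k.castSucc) l := by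
  ext j
  simp only [omitIndex, RelEmbedding.coe_trans, Function.comp_apply, Fin.succAboveOrderEmb_apply]
  congr 2
  rw [Fin.le_def] at h
  ext
  simp only [Fin.succAbove, Fin.lt_def]
  split_ifs <;> simp_all <;> omega

theorem cechD_cechD (i : ℕ) (c : CechCochain M f i) : cechD M f (i + 1) (cechD M f i c) = 0 := by
  ext σ
  rw [cechD_apply]
  simp only [cechD_apply, map_sum, map_zsmul, liftOfLE_liftOfLE]
  exact sum_alternating_eq_zero (fun k l => LocalizedModule.liftOfLE
      (cechMonoid f (omitIndex (omitIndex σ k) l)) (cechMonoid f σ)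
      ((cechMonoid_omitIndex_le f _ l).trans (cechMonoid_omitIndex_le f σ k))
      (c (omitIndex (omitIndex σ k) l)))
    fun k l h => liftOfLE_congr f c (omitIndex_omitIndex σ h) _ _

end Cech

/-! ### Graded pieces of localizations and of the Čech complex -/

section Graded

variable {A M : Type*} [CommRing A] [AddCommGroup M] [Module A M]
  {R : Type*} [CommRing R] [Algebra R A] [Module R M] {s : ℕ}

/-- Multiplication by elements of degree `a` raises the degree by `a`. No directness of the sum of
the pieces is assumed. -/
structure IsGradedAction (𝒜 : (Fin s → ℤ) → Submodule R A) (ℳ : (Fin s → ℤ) → Submodule R M) :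
    Prop where
  one_mem : (1 : A) ∈ 𝒜 0
  mul_mem : ∀ {a b x y}, x ∈ 𝒜 a → y ∈ 𝒜 b → x * y ∈ 𝒜 (a + b)
  smul_mem : ∀ {a b x y}, x ∈ 𝒜 a → y ∈ ℳ b → x • y ∈ ℳ (a + b)

variable {𝒜 : (Fin s → ℤ) → Submodule R A} {ℳ ℳ' : (Fin s → ℤ) → Submodule R M}
  {S T : Submonoid A} {n : Fin s → ℤ}

theorem mk_mem_localizedPiece (a : S) (x : M) {b : Fin s → ℤ} (ha : (a : A) ∈ 𝒜 b)
    (hx : x ∈ ℳ (b + n)) : LocalizedModule.mk x a ∈ localizedPiece 𝒜 ℳ S n :=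
  ⟨a, b, x, ha, hx, rfl⟩

namespace IsGradedAction

variable (h : IsGradedAction 𝒜 ℳ)
include h

theorem zero_mem_localizedPiece : 0 ∈ localizedPiece 𝒜 ℳ S n :=
  ⟨1, 0, 0, h.one_mem, zero_mem _, (LocalizedModule.zero_mk 1).symm⟩

theorem add_mem_localizedPiece {z w : LocalizedModule S M} (hz : z ∈ localizedPiece 𝒜 ℳ S n)
    (hw : w ∈ localizedPiece 𝒜 ℳ S n) : z + w ∈ localizedPiece 𝒜 ℳ S n := by
  obtain ⟨a, b, x, ha, hx, rfl⟩ := hz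
  obtain ⟨a', b', x', ha', hx', rfl⟩ := hw
  rw [LocalizedModule.mk_add_mk]
  refine mk_mem_localizedPiece (b := b + b') _ _ (h.mul_mem ha ha') (add_mem ?_ ?_)
  · have := h.smul_mem ha' hx
    rwa [← add_assoc, add_comm b' b] at this
  · have := h.smul_mem ha hx'
    rwa [← add_assoc] at this

theorem smul_mem_localizedPiece {y : A} {e : Fin s → ℤ} (hy : y ∈ 𝒜 e) {z : LocalizedModule S M}
    (hz : z ∈ localizedPiece 𝒜 ℳ S n) : y • z ∈ localizedPiece 𝒜 ℳ S (n + e) := by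
  obtain ⟨a, b, x, ha, hx, rfl⟩ := hz
  rw [LocalizedModule.smul'_mk]
  refine mk_mem_localizedPiece a _ ha ?_
  have := h.smul_mem hy hx
  rwa [add_comm, add_assoc] at this

omit h in
theorem neg_mem_localizedPiece {z : LocalizedModule S M} (hz : z ∈ localizedPiece 𝒜 ℳ S n) :
    -z ∈ localizedPiece 𝒜 ℳ S n := by
  obtain ⟨a, b, x, ha, hx, rfl⟩ := hz
  rw [← LocalizedModule.mk_neg]
  exact mk_mem_localizedPiece a _ ha (neg_mem hx)

theorem divBy_mem_localizedPiece (a : S) {b : Fin s → ℤ} (ha : (a : A) ∈ 𝒜 b)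
    {z : LocalizedModule S M} (hz : z ∈ localizedPiece 𝒜 ℳ S n) :
    LocalizedModule.divBy a z ∈ localizedPiece 𝒜 ℳ S (n - b) := by
  obtain ⟨a', b', x, ha', hx, rfl⟩ := hz
  rw [LocalizedModule.divBy_apply, LocalizedModule.liftOn_mk]
  refine mk_mem_localizedPiece (b := b' + b) _ _ (h.mul_mem ha' ha) ?_
  convert hx using 2
  abel

omit h in
theorem liftOfLE_mem_localizedPiece (hST : S ≤ T) {z : LocalizedModule S M}
    (hz : z ∈ localizedPiece 𝒜 ℳ S n) :
    LocalizedModule.liftOfLE S T hST z ∈ localizedPiece 𝒜 ℳ T n := by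
  obtain ⟨a, b, x, ha, hx, rfl⟩ := hz
  rw [liftOfLE_mk]
  exact mk_mem_localizedPiece _ _ ha hx

variable (S n) in
/-- The degree `n` piece of a localization, as an additive subgroup. -/
def localizedSubgroup : AddSubgroup (LocalizedModule S M) where
  carrier := localizedPiece 𝒜 ℳ S n
  zero_mem' := h.zero_mem_localizedPiece
  add_mem' := h.add_mem_localizedPiece
  neg_mem' := neg_mem_localizedPiece

/-- Cross-multiplying the two representations puts one element of `M` in both `ℳ` and `ℳ'` at the
same degree, so it vanishes. -/
theorem eq_zero_of_mem_localizedPiece (h' : IsGradedAction 𝒜 ℳ')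
    (hd : ∀ n, Disjoint (ℳ n) (ℳ' n)) (hS : ∀ a ∈ S, ∃ b, a ∈ 𝒜 b) {z : LocalizedModule S M}
    (hz : z ∈ localizedPiece 𝒜 ℳ S n) (hz' : z ∈ localizedPiece 𝒜 ℳ' S n) : z = 0 := by
  obtain ⟨a, b, x, ha, hx, rfl⟩ := hz
  obtain ⟨a', b', x', ha', hx', e⟩ := hz'
  obtain ⟨u, hu⟩ := LocalizedModule.mk_eq.1 e
  obtain ⟨c, hc⟩ := hS u u.2
  have h1 : u • a' • x ∈ ℳ (c + (b' + (b + n))) := h.smul_mem hc (h.smul_mem ha' hx)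
  have h2 : u • a • x' ∈ ℳ' (c + (b + (b' + n))) := h'.smul_mem hc (h'.smul_mem ha hx')
  rw [← hu, add_left_comm b] at h2
  have h0 : (u * a') • x = 0 := by
    rw [mul_smul]
    exact Submodule.disjoint_def.1 (hd _) _ h1 h2
  rw [← LocalizedModule.mk_cancel_common_left (u * a'), h0, LocalizedModule.zero_mk]

omit h in
theorem exists_add_eq_localizedModule (hc : ∀ n, Codisjoint (ℳ n) (ℳ' n))
    (hS : ∀ a ∈ S, ∃ b, a ∈ 𝒜 b) (z : LocalizedModule S M) (n : Fin s → ℤ) :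
    ∃ p ∈ localizedPiece 𝒜 ℳ S n, ∃ q ∈ localizedPiece 𝒜 ℳ' S n, p + q = z := by
  induction z with | _ x a
  obtain ⟨b, hb⟩ := hS a a.2
  obtain ⟨p, hp, q, hq, rfl⟩ :=
    Submodule.mem_sup.1 ((codisjoint_iff.1 (hc (b + n))).symm ▸ Submodule.mem_top : x ∈ _)
  refine ⟨_, mk_mem_localizedPiece a p hb hp, _, mk_mem_localizedPiece a q hb hq, ?_⟩
  rw [LocalizedModule.mk_add_mk, ← smul_add, LocalizedModule.mk_cancel_common_left]

end IsGradedAction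

variable {r : ℕ} {f : Fin r → A}

theorem exists_mem_of_mem_cechMonoid (h : IsGradedAction 𝒜 ℳ) (hf : ∀ j, ∃ n, f j ∈ 𝒜 n) {i : ℕ}
    (σ : Fin i ↪o Fin r) : ∀ a ∈ cechMonoid f σ, ∃ b, a ∈ 𝒜 b := by
  intro a ha
  induction ha using Submonoid.closure_induction with
  | mem x hx =>
    obtain ⟨k, rfl⟩ := hx
    exact hf _
  | one => exact ⟨0, h.one_mem⟩
  | mul x y _ _ hx hy =>
    obtain ⟨b, hb⟩ := hx
    obtain ⟨c, hc⟩ := hy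
    exact ⟨b + c, h.mul_mem hb hc⟩

variable (f) in
/-- The Čech cochains all of whose components have degree `n`. -/
def IsGradedAction.cechPiece (h : IsGradedAction 𝒜 ℳ) (i : ℕ) (n : Fin s → ℤ) :
    AddSubgroup (CechCochain M f i) :=
  AddSubgroup.pi Set.univ fun σ => h.localizedSubgroup (cechMonoid f σ) n

namespace IsGradedAction

variable (h : IsGradedAction 𝒜 ℳ)
include h

theorem mem_cechPiece {i : ℕ} {c : CechCochain M f i} :
    c ∈ h.cechPiece f i n ↔ ∀ σ, c σ ∈ localizedPiece 𝒜 ℳ (cechMonoid f σ) n := by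
  simp only [cechPiece, AddSubgroup.mem_pi, Set.mem_univ, true_imp_iff]
  rfl

theorem smul_mem_cechPiece {y : A} {e : Fin s → ℤ} (hy : y ∈ 𝒜 e) {i : ℕ} {c : CechCochain M f i}
    (hc : c ∈ h.cechPiece f i n) : y • c ∈ h.cechPiece f i (n + e) :=
  h.mem_cechPiece.2 fun σ => h.smul_mem_localizedPiece hy (h.mem_cechPiece.1 hc σ)

theorem cechD_mem_cechPiece {i : ℕ} {c : CechCochain M f i} (hc : c ∈ h.cechPiece f i n) :
    cechD M f i c ∈ h.cechPiece f (i + 1) n := by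
  rw [mem_cechPiece] at hc ⊢
  intro σ
  rw [cechD_apply]
  exact AddSubgroup.sum_mem (h.localizedSubgroup (cechMonoid f σ) n)
    fun k _ => AddSubgroup.zsmul_mem _ (liftOfLE_mem_localizedPiece _ (hc _)) _

/-- Split `w = p + q` into its degree `n` part and the rest. Then `d q` lies both in degree `n` and
in the complement, so it is zero and `p` is a homogeneous primitive. -/
theorem exists_mem_cechPiece_cechD_eq (h' : IsGradedAction 𝒜 ℳ') (hM : ∀ n, IsCompl (ℳ n) (ℳ' n))
    (hf : ∀ j, ∃ n, f j ∈ 𝒜 n) {i : ℕ} (w : CechCochain M f i)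
    (hw : cechD M f i w ∈ h.cechPiece f (i + 1) n) :
    ∃ w' ∈ h.cechPiece f i n, cechD M f i w' = cechD M f i w := by
  choose p hp q hq hpq using fun σ => exists_add_eq_localizedModule (fun n => (hM n).codisjoint)
    (exists_mem_of_mem_cechMonoid h hf σ) (w σ) n
  have hp' : p ∈ h.cechPiece f i n := h.mem_cechPiece.2 hp
  have hq' : q ∈ h'.cechPiece f i n := h'.mem_cechPiece.2 hq
  have hw' : w = p + q := (funext hpq).symm
  refine ⟨p, hp', ?_⟩
  rw [hw', map_add, left_eq_add]
  have h1 : cechD M f i q ∈ h.cechPiece f (i + 1) n := by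
    rw [← add_sub_cancel_left (cechD M f i p) (cechD M f i q), ← map_add, ← hw']
    exact sub_mem hw (h.cechD_mem_cechPiece hp')
  ext σ
  exact h.eq_zero_of_mem_localizedPiece h' (fun n => (hM n).disjoint)
    (exists_mem_of_mem_cechMonoid h hf σ) (h.mem_cechPiece.1 h1 σ)
    (h'.mem_cechPiece.1 (h'.cechD_mem_cechPiece hq') σ)

theorem mem_cechCoboundaries_of_cohomologyPiece_subset {i : ℕ}
    (H : cohomologyPiece f 𝒜 ℳ i n ⊆ {0}) {c : CechCochain M f i} (hc : c ∈ h.cechPiece f i n)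
    (hd : cechD M f i c = 0) : c ∈ cechCoboundaries M f i := by
  have := H ⟨⟨c, hd⟩, h.mem_cechPiece.1 hc, rfl⟩
  rw [Set.mem_singleton_iff, Submodule.Quotient.mk_eq_zero] at this
  exact this

end IsGradedAction

end Graded

/-! ### Castelnuovo–Mumford regularity and generators -/

section Regularity

variable {A M : Type*} [CommRing A] [AddCommGroup M] [Module A M]
  {R : Type*} [CommRing R] [Algebra R A] [Module R M] {s : ℕ}
  {𝒜 : (Fin s → ℤ) → Submodule R A} {ℳ ℳ' : (Fin s → ℤ) → Submodule R M}
  {r : ℕ} {f : Fin r → A} {L : Type*} [Fintype L] {y : L → A} {e : Fin s → ℤ}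

/-- The elements `f j` are homogeneous, and homogeneous combinations of the elements `y l` of
degree `e`. -/
def IsHomogeneousCombination (𝒜 : (Fin s → ℤ) → Submodule R A) (y : L → A) (e : Fin s → ℤ)
    (f : Fin r → A) : Prop :=
  ∀ j, ∃ b, f j ∈ 𝒜 b ∧ ∃ a : L → A, (∀ l, a l ∈ 𝒜 (b - e)) ∧ ∑ l, y l * a l = f j

/-- Exactness in the Koszul direction. In the component `σ` of a cochain of positive index, `f (σ
0)` is invertible, so `∑ l, y l * (a l / f (σ 0)) = 1` and the prepending homotopy applies. The
factor `a l / f (σ 0)` has degree `-e`. -/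
theorem IsGradedAction.exists_listKoszulD_eq (h : IsGradedAction 𝒜 ℳ)
    (hf : IsHomogeneousCombination 𝒜 y e f) {i p : ℕ} {n : Fin s → ℤ}
    (c : List L → CechCochain M f (i + 1))
    (hc : ∀ τ, τ.length = p → c τ ∈ h.cechPiece f (i + 1) n)
    (hD : ∀ τ, τ.length + 1 = p → listKoszulD y τ c = 0) :
    ∃ x : List L → CechCochain M f (i + 1),
      (∀ τ, τ.length = p + 1 → x τ ∈ h.cechPiece f (i + 1) (n - e)) ∧
      ∀ τ, τ.length = p → listKoszulD y τ x = c τ := by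
  choose b hb a ha hya using hf
  have hmem (σ : Fin (i + 1) ↪o Fin r) : f (σ 0) ∈ cechMonoid f σ :=
    Submonoid.subset_closure ⟨0, rfl⟩
  let g : L → CechCochain M f (i + 1) →ₗ[A] CechCochain M f (i + 1) := fun l =>
    LinearMap.pi fun σ => a (σ 0) l • (LocalizedModule.divBy ⟨f (σ 0), hmem σ⟩ ∘ₗ
      LinearMap.proj σ)
  have hg_apply (l : L) (z : CechCochain M f (i + 1)) (σ) :
      g l z σ = a (σ 0) l • LocalizedModule.divBy ⟨f (σ 0), hmem σ⟩ (z σ) := rfl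
  have hg : ∀ z, ∑ l, y l • g l z = z := by
    intro z
    ext σ
    rw [Finset.sum_apply]
    simp only [Pi.smul_apply, hg_apply, smul_smul]
    rw [← Finset.sum_smul, hya]
    exact LocalizedModule.mul_by_divBy (⟨f (σ 0), hmem σ⟩ : cechMonoid f σ) (z σ)
  refine ⟨listKoszulH g c, ?_, ?_⟩
  · rintro (_ | ⟨l, τ⟩) hτ
    · simp at hτ
    · rw [h.mem_cechPiece]
      intro σ
      have := h.smul_mem_localizedPiece (ha (σ 0) l) (h.divBy_mem_localizedPiece
        (⟨f (σ 0), hmem σ⟩ : cechMonoid f σ) (hb (σ 0))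
        (h.mem_cechPiece.1 (hc τ (by simpa using hτ)) σ))
      rwa [sub_add_sub_cancel] at this
  · intro τ hτ
    rw [listKoszulD_listKoszulH y g hg, sub_eq_self]
    cases τ with
    | nil => rfl
    | cons l τ => simp [listKoszulH, hD τ hτ]

/-- The double complex chase, by descending induction on `p`, with `d` the Čech and `D` the list
differential. Write `d c = D x`; then `D (d x) = d (d c) = 0`, so by induction some `x - D w`
consists of Čech cocycles. The vanishing of `H^{p+1}` in degree `k - p • e` gives `x - D w = d u`,
whence `d (D u) = D x = d c` and `u` is the correction sought. -/
theorem IsGradedAction.exists_cechD_sub_listKoszulD_eq_zero (h : IsGradedAction 𝒜 ℳ)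
    (h' : IsGradedAction 𝒜 ℳ') (hM : ∀ n, IsCompl (ℳ n) (ℳ' n))
    (hy : ∀ l, y l ∈ 𝒜 e) (hf : IsHomogeneousCombination 𝒜 y e f) {k : Fin s → ℤ}
    (H : ∀ i : ℕ, cohomologyPiece f 𝒜 ℳ (i + 1) (k - i • e) ⊆ {0}) (t p : ℕ) (ht : r + 1 ≤ p + t)
    (c : List L → CechCochain M f p)
    (hc : ∀ τ, τ.length = p → c τ ∈ h.cechPiece f p (k + e - p • e))
    (hD : ∀ τ, τ.length + 1 = p → listKoszulD y τ (fun τ' => cechD M f p (c τ')) = 0) :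
    ∃ w : List L → CechCochain M f p,
      (∀ τ, τ.length = p + 1 → w τ ∈ h.cechPiece f p (k - p • e)) ∧
      ∀ τ, τ.length = p → cechD M f p (c τ - listKoszulD y τ w) = 0 := by
  induction t generalizing p with
  | zero =>
    refine ⟨0, fun _ _ => zero_mem _, fun τ _ => ?_⟩
    -- For `p > r` no increasing `(p + 1)`-tuple of indices exists, so the target of the Čech
    -- differential is trivial.
    ext σ
    have := Fintype.card_le_of_embedding σ.toEmbedding
    simp only [Fintype.card_fin] at this
    omega
  | succ t ih =>
    obtain ⟨x, hx, hxD⟩ := h.exists_listKoszulD_eq hf (fun τ => cechD M f p (c τ))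
      (fun τ hτ => h.cechD_mem_cechPiece (hc τ hτ)) hD
    have hdeg : k + e - p • e - e = k - p • e := by abel
    have hdeg' : k + e - (p + 1) • e = k - p • e := by rw [succ_nsmul]; abel
    have hdeg'' : k - (p + 1) • e + e = k - p • e := by rw [succ_nsmul]; abel
    rw [hdeg] at hx
    obtain ⟨w, hw, hwD⟩ := ih (p + 1) (by omega) x (by rwa [hdeg']) fun τ hτ => by
      rw [← map_listKoszulD, hxD τ (by simpa using hτ), cechD_cechD]
    have hex (τ : List L) : ∃ u : CechCochain M f p, τ.length = p + 1 →
        u ∈ h.cechPiece f p (k - p • e) ∧ cechD M f p u = x τ - listKoszulD y τ w := by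
      by_cases hτ : τ.length = p + 1
      · have hmem : x τ - listKoszulD y τ w ∈ h.cechPiece f (p + 1) (k - p • e) := by
          refine sub_mem (hx τ hτ) ?_
          have := listKoszulD_mem y (fun n => h.cechPiece f (p + 1) n) e
            (fun l n z hz => h.smul_mem_cechPiece (hy l) hz) τ _ w
            (fun τ' hτ' => hw τ' (by rw [hτ', hτ]))
          rwa [hdeg''] at this
        obtain ⟨u, hu⟩ := h.mem_cechCoboundaries_of_cohomologyPiece_subset (H p) hmem (hwD τ hτ)
        obtain ⟨u', hu', hu''⟩ := h.exists_mem_cechPiece_cechD_eq h' hM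
          (fun j => (hf j).imp fun _ hb => hb.1) u (by rwa [hu])
        exact ⟨u', fun _ => ⟨hu', hu''.trans hu⟩⟩
      · exact ⟨0, fun h => absurd h hτ⟩
    choose u hu using hex
    refine ⟨u, fun τ hτ => (hu τ hτ).1, fun τ hτ => ?_⟩
    rw [map_sub, map_listKoszulD, ← hxD τ hτ,
      listKoszulD_congr y τ (c' := fun τ' => x τ' - listKoszulD y τ' w)
        (fun τ' hτ' => (hu τ' (by rw [hτ', hτ])).2),
      listKoszulD_sub, listKoszulD_listKoszulD, sub_zero, sub_self]

/-- Needed because the degree `b` of a denominator is not assumed unique: multiplying by `1 ∈ 𝒜 b`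
carries the splitting of `x` in degree `n` to degree `b + n`, where its `ℳ'` part must vanish. -/
theorem IsGradedAction.mem_of_one_mem (h : IsGradedAction 𝒜 ℳ) (h' : IsGradedAction 𝒜 ℳ')
    (hM : ∀ n, IsCompl (ℳ n) (ℳ' n)) {b n : Fin s → ℤ} (hb : (1 : A) ∈ 𝒜 b) {x : M}
    (hx : x ∈ ℳ (b + n)) : x ∈ ℳ n := by
  obtain ⟨p, hp, q, hq, rfl⟩ :=
    Submodule.mem_sup.1 ((hM n).sup_eq_top.symm ▸ Submodule.mem_top : x ∈ _)
  have h1 := h.smul_mem hb hp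
  have h2 := h'.smul_mem hb hq
  rw [one_smul] at h1 h2
  have h3 : q = 0 := Submodule.disjoint_def.1 (hM (b + n)).disjoint q
    ((Submodule.add_mem_iff_right _ h1).1 hx) h2
  rwa [h3, add_zero]

theorem mk_one_injective_of_fin_zero (σ : Fin 0 ↪o Fin r) :
    Function.Injective fun x : M => (LocalizedModule.mk x 1 : LocalizedModule (cechMonoid f σ) M) := by
  intro x x' hx
  obtain ⟨⟨u, hu⟩, hux⟩ := LocalizedModule.mk_eq.1 hx
  have hu1 : u = 1 := by simpa [cechMonoid, Set.range_eq_empty] using hu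
  subst hu1
  simpa [Submonoid.smul_def] using hux

theorem IsGradedAction.exists_mk_eq_of_fin_zero (h : IsGradedAction 𝒜 ℳ)
    (h' : IsGradedAction 𝒜 ℳ') (hM : ∀ n, IsCompl (ℳ n) (ℳ' n)) (σ : Fin 0 ↪o Fin r)
    {n : Fin s → ℤ} {z : LocalizedModule (cechMonoid f σ) M}
    (hz : z ∈ localizedPiece 𝒜 ℳ (cechMonoid f σ) n) : ∃ x ∈ ℳ n, z = LocalizedModule.mk x 1 := by
  obtain ⟨⟨a, ha⟩, b, x, hab, hx, rfl⟩ := hz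
  have ha1 : a = 1 := by simpa [cechMonoid, Set.range_eq_empty] using ha
  subst ha1
  exact ⟨x, h.mem_of_one_mem h' hM hab hx, rfl⟩

/-- Castelnuovo–Mumford: if the local cohomology with respect to `(f)` vanishes in the degrees
prescribed by regularity in the direction `e`, then `M` is generated in degree `k + e` by `M_k`. -/
theorem IsGradedAction.exists_eq_sum_smul (h : IsGradedAction 𝒜 ℳ)
    (h' : IsGradedAction 𝒜 ℳ') (hM : ∀ n, IsCompl (ℳ n) (ℳ' n))
    (hy : ∀ l, y l ∈ 𝒜 e) (hf : IsHomogeneousCombination 𝒜 y e f) {k : Fin s → ℤ}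
    (H0 : cohomologyPiece f 𝒜 ℳ 0 (k + e) ⊆ {0})
    (H : ∀ i : ℕ, cohomologyPiece f 𝒜 ℳ (i + 1) (k - i • e) ⊆ {0}) {x : M} (hx : x ∈ ℳ (k + e)) :
    ∃ w : L → M, (∀ l, w l ∈ ℳ k) ∧ x = ∑ l, y l • w l := by
  have hx' : (fun _ => LocalizedModule.mk x 1 : CechCochain M f 0) ∈ h.cechPiece f 0 (k + e) :=
    h.mem_cechPiece.2 fun σ => mk_mem_localizedPiece 1 x h.one_mem (by rwa [zero_add])
  -- At `p = 0` the chase makes `x - ∑ l, y l • w [l]` a Čech 0-cocycle of degree `k + e`, which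
  -- `H0` then kills.
  obtain ⟨w, hw, hD⟩ := h.exists_cechD_sub_listKoszulD_eq_zero h' hM hy hf H (r + 1) 0 (by simp)
    (fun _ _ => LocalizedModule.mk x 1) (fun τ _ => by simpa using hx') (by simp)
  simp only [zero_smul, sub_zero] at hw
  have hmem := sub_mem hx' (listKoszulD_mem y (fun n => h.cechPiece f 0 n) e
    (fun l n z hz => h.smul_mem_cechPiece (hy l) hz) [] _ w hw)
  have h0 := h.mem_cechCoboundaries_of_cohomologyPiece_subset H0 hmem (hD [] rfl)
  rw [cechCoboundaries, Submodule.mem_bot, sub_eq_zero] at h0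
  let σ : Fin 0 ↪o Fin r := OrderEmbedding.ofIsEmpty
  choose v hv hwv using fun l => h.exists_mk_eq_of_fin_zero h' hM σ
    (h.mem_cechPiece.1 (hw [l] rfl) σ)
  refine ⟨v, hv, mk_one_injective_of_fin_zero (f := f) σ ?_⟩
  have h1 := congrFun h0 σ
  simp only [listKoszulD, Finset.sum_apply, Pi.smul_apply, hwv] at h1
  refine h1.trans ?_
  change _ = LocalizedModule.mkLinearMap (cechMonoid f σ) M _
  simp [LocalizedModule.mkLinearMap_apply]

end Regularity

/-! ### Homogeneous coefficients for combinations of the `y l`. -/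

section Combination

variable {A : Type*} [CommRing A] {R : Type*} [CommRing R] [Algebra R A] {s : ℕ}
  {𝒜 𝒜' : (Fin s → ℤ) → Submodule R A} {r : ℕ} {f : Fin r → A} {L : Type*} [Fintype L]
  {y : L → A} {e : Fin s → ℤ}

/-- Keep only the degree `b - e` part of each coefficient; the discarded parts contribute to the
complement of `𝒜 b`, hence nothing. -/
theorem IsGradedAction.isHomogeneousCombination (h : IsGradedAction 𝒜 𝒜)
    (h' : IsGradedAction 𝒜 𝒜') (hA : ∀ n, IsCompl (𝒜 n) (𝒜' n)) (hy : ∀ l, y l ∈ 𝒜 e)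
    (hf : ∀ j, ∃ n, f j ∈ 𝒜 n) (hfy : ∀ j, f j ∈ Ideal.span (Set.range y)) :
    IsHomogeneousCombination 𝒜 y e f := by
  intro j
  obtain ⟨b, hb⟩ := hf j
  obtain ⟨a, ha⟩ := Ideal.mem_span_range_iff_exists_fun.1 (hfy j)
  choose p hp q hq hpq using fun l => Submodule.mem_sup.1
    ((hA (b - e)).sup_eq_top.symm ▸ Submodule.mem_top : a l ∈ _)
  have h1 : ∑ l, y l * p l ∈ 𝒜 b := sum_mem fun l _ => by
    have := h.smul_mem (hy l) (hp l)
    rwa [add_sub_cancel] at this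
  have h2 : ∑ l, y l * q l ∈ 𝒜' b := sum_mem fun l _ => by
    have := h'.smul_mem (hy l) (hq l)
    rwa [add_sub_cancel] at this
  have h3 : f j = ∑ l, y l * p l + ∑ l, y l * q l := by
    rw [← ha, ← Finset.sum_add_distrib]
    exact Finset.sum_congr rfl fun l _ => by rw [← mul_add, hpq, mul_comm]
  rw [h3] at hb
  have h4 := Submodule.disjoint_def.1 (hA b).disjoint _ ((Submodule.add_mem_iff_right _ h1).1 hb) h2
  exact ⟨b, h3 ▸ hb, p, hp, by rw [h3, h4, add_zero]⟩

end Combination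

/-! ### The gradings of the associated graded rings -/

variable {R : Type*} [CommRing R] {s : ℕ}

theorem coeff_single_mul_apply (a k : Fin s → ℤ) (c : R) (x : AddMonoidAlgebra R (Fin s → ℤ)) :
    (AddMonoidAlgebra.single a c * x).coeff k = c * x.coeff (k - a) :=
  AddMonoidAlgebra.coeff_single_mul_eq_mul_coeff _ fun m _ => by
    rw [eq_sub_iff_add_eq, add_comm]

theorem eq_single_of_forall_ne {x : AddMonoidAlgebra R (Fin s → ℤ)} {n : Fin s → ℤ}
    (h : ∀ k, k ≠ n → x.coeff k = 0) : x = AddMonoidAlgebra.single n (x.coeff n) := by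
  classical
  ext k
  rw [AddMonoidAlgebra.coeff_single, Finsupp.single_apply]
  split_ifs with hk
  · rw [hk]
  · exact h k (Ne.symm hk)

namespace MultiFiltration

variable {I : Fin s → Ideal R} (F : MultiFiltration I)

/-- The monomial `a t^n` of the Rees ring. -/
def reesMonomial {n : Fin s → ℤ} {a : R} (ha : a ∈ F.nonnegIdeal n) : F.rees :=
  ⟨AddMonoidAlgebra.single n a, fun k => by
    classical
    rw [AddMonoidAlgebra.coeff_single, Finsupp.single_apply]
    split_ifs with hk
    · exact hk ▸ ha
    · exact zero_mem _⟩

theorem coeff_reesMonomial_self {n : Fin s → ℤ} {a : R} (ha : a ∈ F.nonnegIdeal n) :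
    (F.reesMonomial ha).1.coeff n = a := by
  classical
  simp [reesMonomial]

theorem coeff_reesMonomial_of_ne {n k : Fin s → ℤ} {a : R} (ha : a ∈ F.nonnegIdeal n)
    (hk : k ≠ n) : (F.reesMonomial ha).1.coeff k = 0 := by
  classical
  simp [reesMonomial, hk.symm]

theorem nonnegIdeal_of_nonneg {n : Fin s → ℤ} (hn : 0 ≤ n) : F.nonnegIdeal n = F.ideal n :=
  if_pos hn

theorem assocMk_eq_zero {x : F.rees} : F.assocMk x = 0 ↔ x ∈ F.reesShift :=
  Ideal.Quotient.eq_zero_iff_mem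

theorem assocMk_surjective : Function.Surjective F.assocMk := Ideal.Quotient.mk_surjective

theorem mem_assocPiece {n : Fin s → ℤ} {x : F.assocRing} :
    x ∈ F.assocPiece n ↔ ∃ z : F.rees, (∀ k, k ≠ n → z.1.coeff k = 0) ∧ F.assocMk z = x :=
  Iff.rfl

/-- The classes of the elements of `R(F)` without term of degree `n`. -/
def assocCopiece (n : Fin s → ℤ) : Submodule R F.assocRing :=
  Submodule.map F.assocMk.toLinearMap
    { carrier := {x : F.rees | x.1.coeff n = 0}
      zero_mem' := rfl
      add_mem' := fun {x y} hx hy => by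
        change x.1.coeff n + y.1.coeff n = 0
        rw [hx, hy, add_zero]
      smul_mem' := fun a x hx => by
        change a • x.1.coeff n = 0
        rw [hx, smul_zero] }

theorem mem_assocCopiece {n : Fin s → ℤ} {x : F.assocRing} :
    x ∈ F.assocCopiece n ↔ ∃ z : F.rees, z.1.coeff n = 0 ∧ F.assocMk z = x :=
  Iff.rfl

theorem assocMk_reesMonomial_mem {n : Fin s → ℤ} {a : R} (ha : a ∈ F.nonnegIdeal n) :
    F.assocMk (F.reesMonomial ha) ∈ F.assocPiece n :=
  F.mem_assocPiece.2 ⟨_, fun _ hk => F.coeff_reesMonomial_of_ne ha hk, rfl⟩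

theorem exists_eq_assocMk_reesMonomial {n : Fin s → ℤ} {x : F.assocRing}
    (hx : x ∈ F.assocPiece n) :
    ∃ (a : R) (ha : a ∈ F.nonnegIdeal n), x = F.assocMk (F.reesMonomial ha) := by
  obtain ⟨z, hz, rfl⟩ := F.mem_assocPiece.1 hx
  exact ⟨_, z.2 n, congrArg _ (Subtype.ext (eq_single_of_forall_ne hz))⟩

theorem assocMk_reesMonomial_eq_zero {n : Fin s → ℤ} {a : R} (ha : a ∈ F.nonnegIdeal n) :
    F.assocMk (F.reesMonomial ha) = 0 ↔ a ∈ F.ideal (n + 1) := by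
  rw [assocMk_eq_zero]
  constructor
  · intro h
    have := h n
    rwa [coeff_reesMonomial_self] at this
  · intro h k
    by_cases hk : k = n
    · subst hk
      rwa [coeff_reesMonomial_self]
    · rw [coeff_reesMonomial_of_ne F ha hk]
      exact zero_mem _

theorem isCompl_assocPiece (n : Fin s → ℤ) : IsCompl (F.assocPiece n) (F.assocCopiece n) := by
  constructor
  · rw [Submodule.disjoint_def]
    intro x hx hx'
    obtain ⟨a, ha, rfl⟩ := F.exists_eq_assocMk_reesMonomial hx
    obtain ⟨z, hz, hzx⟩ := F.mem_assocCopiece.1 hx'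
    rw [assocMk_reesMonomial_eq_zero]
    have := F.assocMk_eq_zero.1 (show F.assocMk (F.reesMonomial ha - z) = 0 by
      rw [map_sub, hzx, sub_self]) n
    change (F.reesMonomial ha).1.coeff n - z.1.coeff n ∈ _ at this
    rwa [hz, sub_zero, coeff_reesMonomial_self] at this
  · rw [codisjoint_iff, eq_top_iff]
    intro x _
    obtain ⟨z, rfl⟩ := F.assocMk_surjective x
    rw [← add_sub_cancel (F.assocMk (F.reesMonomial (z.2 n))) (F.assocMk z)]
    refine Submodule.add_mem_sup (F.assocMk_reesMonomial_mem _)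
      (F.mem_assocCopiece.2 ⟨z - F.reesMonomial (z.2 n), ?_, map_sub _ _ _⟩)
    change z.1.coeff n - (F.reesMonomial (z.2 n)).1.coeff n = 0
    rw [coeff_reesMonomial_self, sub_self]

theorem one_mem_assocPiece : (1 : F.assocRing) ∈ F.assocPiece 0 := by
  classical
  refine F.mem_assocPiece.2 ⟨1, fun k hk => ?_, map_one _⟩
  change (1 : AddMonoidAlgebra R (Fin s → ℤ)).coeff k = 0
  rw [AddMonoidAlgebra.one_def, AddMonoidAlgebra.coeff_single, Finsupp.single_apply, if_neg hk.symm]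

theorem mul_mem_assocPiece {a b : Fin s → ℤ} {x y : F.assocRing} (hx : x ∈ F.assocPiece a)
    (hy : y ∈ F.assocPiece b) : x * y ∈ F.assocPiece (a + b) := by
  obtain ⟨c, hc, rfl⟩ := F.exists_eq_assocMk_reesMonomial hx
  obtain ⟨z, hz, rfl⟩ := F.mem_assocPiece.1 hy
  refine F.mem_assocPiece.2 ⟨F.reesMonomial hc * z, fun k hk => ?_, map_mul _ _ _⟩
  change (AddMonoidAlgebra.single a c * z.1).coeff k = 0
  rw [coeff_single_mul_apply, hz, mul_zero]
  rintro rfl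
  exact hk (by abel)

theorem mul_mem_assocCopiece {a b : Fin s → ℤ} {x y : F.assocRing} (hx : x ∈ F.assocPiece a)
    (hy : y ∈ F.assocCopiece b) : x * y ∈ F.assocCopiece (a + b) := by
  obtain ⟨c, hc, rfl⟩ := F.exists_eq_assocMk_reesMonomial hx
  obtain ⟨z, hz, rfl⟩ := F.mem_assocCopiece.1 hy
  refine F.mem_assocCopiece.2 ⟨F.reesMonomial hc * z, ?_, map_mul _ _ _⟩
  change (AddMonoidAlgebra.single a c * z.1).coeff (a + b) = 0
  rw [coeff_single_mul_apply, add_sub_cancel_left, hz, mul_zero]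

theorem assocMap_mem_assocPiece {a : Fin s → ℤ} {x : (adic I).assocRing}
    (hx : x ∈ (adic I).assocPiece a) : F.assocMap x ∈ F.assocPiece a := by
  obtain ⟨z, hz, rfl⟩ := (adic I).mem_assocPiece.1 hx
  exact F.mem_assocPiece.2 ⟨Subalgebra.inclusion F.adic_rees_le z, hz, rfl⟩

theorem isGradedAction_assocPiece_self : IsGradedAction F.assocPiece F.assocPiece :=
  ⟨F.one_mem_assocPiece, F.mul_mem_assocPiece, F.mul_mem_assocPiece⟩

theorem isGradedAction_assocCopiece_self : IsGradedAction F.assocPiece F.assocCopiece :=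
  ⟨F.one_mem_assocPiece, F.mul_mem_assocPiece, F.mul_mem_assocCopiece⟩

theorem isGradedAction_assocPiece :
    letI : Module (adic I).assocRing F.assocRing := F.assocMap.toModule
    IsGradedAction (adic I).assocPiece F.assocPiece :=
  letI : Module (adic I).assocRing F.assocRing := F.assocMap.toModule
  ⟨(adic I).one_mem_assocPiece, (adic I).mul_mem_assocPiece,
    fun hx hy => F.mul_mem_assocPiece (F.assocMap_mem_assocPiece hx) hy⟩

theorem isGradedAction_assocCopiece :
    letI : Module (adic I).assocRing F.assocRing := F.assocMap.toModule
    IsGradedAction (adic I).assocPiece F.assocCopiece :=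
  letI : Module (adic I).assocRing F.assocRing := F.assocMap.toModule
  ⟨(adic I).one_mem_assocPiece, (adic I).mul_mem_assocPiece,
    fun hx hy => F.mul_mem_assocCopiece (F.assocMap_mem_assocPiece hx) hy⟩

theorem assocPiece_eq_bot_of_not_nonneg {n : Fin s → ℤ} (hn : ¬ 0 ≤ n) : F.assocPiece n = ⊥ := by
  rw [eq_bot_iff]
  intro x hx
  obtain ⟨a, ha, rfl⟩ := F.exists_eq_assocMk_reesMonomial hx
  rw [Submodule.mem_bot, assocMk_reesMonomial_eq_zero]
  rw [nonnegIdeal, if_neg hn, Submodule.mem_bot] at ha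
  rw [ha]
  exact zero_mem _

theorem ideal_le_of_assocPiece_eq_bot {n : Fin s → ℤ} (hn : 0 ≤ n) (h : F.assocPiece n = ⊥) :
    F.ideal n ≤ F.ideal (n + 1) := by
  intro a ha
  rw [← F.nonnegIdeal_of_nonneg hn] at ha
  rw [← F.assocMk_reesMonomial_eq_zero ha, ← Submodule.mem_bot R, ← h]
  exact F.assocMk_reesMonomial_mem ha

end MultiFiltration

/-! ### Generators of the irrelevant ideal -/

variable {I : Fin s → Ideal R}

theorem idealPow_eq_mul_sub_single {n : Fin s → ℤ} {j : Fin s} (hn : 1 ≤ n j) :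
    idealPow I n = idealPow I (n - Pi.single j 1) * I j := by
  classical
  have hj : ((n - Pi.single j 1 : Fin s → ℤ) j).toNat + 1 = (n j).toNat := by
    simp only [Pi.sub_apply, Pi.single_eq_same]
    omega
  have hi : ∀ i ≠ j, (n - Pi.single j 1 : Fin s → ℤ) i = n i := fun i hi => by
    rw [Pi.sub_apply, Pi.single_eq_of_ne hi, sub_zero]
  generalize n - Pi.single j 1 = n' at *
  rw [idealPow, idealPow, ← Finset.mul_prod_erase Finset.univ _ (Finset.mem_univ j),
    ← Finset.mul_prod_erase Finset.univ (fun i => I i ^ (n' i).toNat) (Finset.mem_univ j),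
    mul_right_comm, ← pow_succ, hj]
  congr 1
  exact Finset.prod_congr rfl fun i hij => by rw [hi i (Finset.ne_of_mem_erase hij)]

theorem mem_nonnegIdeal_single {j : Fin s} {a : R} (ha : a ∈ I j) :
    a ∈ (adic I).nonnegIdeal (Pi.single j 1) := by
  rw [(adic I).nonnegIdeal_of_nonneg (Pi.single_nonneg.2 zero_le_one)]
  change a ∈ idealPow I _
  rw [idealPow_eq_mul_sub_single (j := j) (by simp), sub_self, idealPow_zero, one_mul]
  exact ha

/-- If `n ≥ e` then `n j ≥ 1`, so `I^n = I^{n - e_j} I_j` and one factor can be expanded in the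
generators `x l`. -/
theorem irrelevantIdeal_le_span (j : Fin s) {L : Type*} [Fintype L] (x : L → R)
    (hx : Ideal.span (Set.range x) = I j) (hxI : ∀ l, x l ∈ I j) :
    irrelevantIdeal (adic I).assocPiece ≤ Ideal.span (Set.range fun l =>
      (adic I).assocMk ((adic I).reesMonomial (mem_nonnegIdeal_single (hxI l)))) := by
  refine Ideal.span_le.2 ?_
  rintro z ⟨n, hn, hz⟩
  obtain ⟨a, ha, rfl⟩ := (adic I).exists_eq_assocMk_reesMonomial hz
  have hn0 : 0 ≤ n := zero_le_one.trans hn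
  have hn1 : 0 ≤ n - Pi.single j 1 := by
    classical
    intro i
    have := hn i
    by_cases hi : i = j
    · subst hi
      simpa using this
    · simpa [Pi.single_eq_of_ne hi] using hn0 i
  have ha' := ha
  rw [(adic I).nonnegIdeal_of_nonneg hn0] at ha'
  change a ∈ idealPow I n at ha'
  rw [idealPow_eq_mul_sub_single (hn j), ← hx, ← smul_eq_mul,
    Submodule.mem_ideal_smul_span_iff_exists_sum] at ha'
  obtain ⟨c, hc, hca⟩ := ha'
  rw [Finsupp.sum_fintype _ _ (by simp)] at hca
  have hc' (l : L) : c l ∈ (adic I).nonnegIdeal (n - Pi.single j 1) := by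
    rw [(adic I).nonnegIdeal_of_nonneg hn1]
    exact hc l
  refine Ideal.mem_span_range_iff_exists_fun.2
    ⟨fun l => (adic I).assocMk ((adic I).reesMonomial (hc' l)), ?_⟩
  simp only [← map_mul, ← map_sum]
  congr 1
  ext1
  simp only [AddSubmonoidClass.coe_finsetSum, MulMemClass.coe_mul, MultiFiltration.reesMonomial,
    AddMonoidAlgebra.single_mul_single, sub_add_cancel, ← hca, smul_eq_mul]
  exact (map_sum (AddMonoidAlgebra.singleAddHom n) _ _).symm

/-! ### From a negative coordinate of a regular vector to the vanishing of `F(N)`. -/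

namespace MultiFiltration

variable (F : MultiFiltration I)

theorem assocPiece_eq_bot_of_mem_regAssoc [IsNoetherianRing R] {m : Fin s → ℤ}
    (hm : m ∈ F.regAssoc) {j : Fin s} (hj : m j < 0) {k : Fin s → ℤ} (hk : m ≤ k) :
    F.assocPiece k = ⊥ := by
  let : Module (adic I).assocRing F.assocRing := F.assocMap.toModule
  obtain ⟨r, f, hf, H0, H⟩ : IsRegularVector (adic I).assocPiece F.assocPiece m := hm
  obtain ⟨S, hS⟩ := (IsNoetherian.noetherian (I j) : (I j).FG)
  have hSr : Ideal.span (Set.range ((↑) : S → R)) = I j := by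
    rw [Subtype.range_coe_subtype]
    exact hS
  have hSI (l : S) : (l : R) ∈ I j := hSr ▸ Ideal.subset_span ⟨l, rfl⟩
  have hy (l : S) := (adic I).assocMk_reesMonomial_mem (mem_nonnegIdeal_single (hSI l))
  have hfy := (adic I).isGradedAction_assocPiece_self.isHomogeneousCombination
    (adic I).isGradedAction_assocCopiece_self (adic I).isCompl_assocPiece hy hf.1
    fun i => irrelevantIdeal_le_span j _ hSr hSI (hf.2 ▸ Ideal.subset_span ⟨i, rfl⟩)
  -- Induction on a bound for `k j`: below `0` the piece vanishes trivially, and each step moves by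
  -- `e_j`.
  obtain ⟨t, ht⟩ : ∃ t : ℕ, k j < t := ⟨(k j).toNat + 1, by omega⟩
  induction t generalizing k with
  | zero => exact F.assocPiece_eq_bot_of_not_nonneg fun h => absurd (h j) (not_le.2 ht)
  | succ t ih =>
    by_cases hkt : k j < t
    · exact ih hk hkt
    obtain ⟨k, rfl⟩ : ∃ k' : Fin s → ℤ, k = k' + Pi.single j 1 :=
      ⟨k - Pi.single j 1, by simp⟩
    rw [Pi.add_apply, Pi.single_eq_same] at hkt ht
    have hmk : m ≤ k := by
      intro i
      by_cases hi : i = j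
      · subst hi
        -- The sign of `m j` enters here: `k j + 1 = t ≥ 0`, so `k j ≥ -1 ≥ m j`.
        have : m i ≤ k i := by omega
        exact this
      · simpa [Pi.single_eq_of_ne hi] using hk i
    have hn : (fun l => (((k l - m l).toNat : ℕ) : ℤ)) + m = k := by
      ext i
      have : m i ≤ k i := hmk i
      simp only [Pi.add_apply]
      omega
    have hbot := ih hmk (by omega)
    rw [eq_bot_iff]
    intro x hx
    obtain ⟨w, hw, rfl⟩ := F.isGradedAction_assocPiece.exists_eq_sum_smul
      F.isGradedAction_assocCopiece F.isCompl_assocPiece hy hfy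
      (by simpa only [hn] using H0 (fun l => (k l - m l).toNat) j)
      (fun i => by
        -- Only the shifts `p = i e_j` from the definition of regularity are needed.
        have := H (fun l => (k l - m l).toNat) (i + 1) (Pi.single j i) (by omega)
          (by simp)
        rw [hn] at this
        convert this using 3
        ext l
        by_cases hl : l = j
        · subst hl
          simp
        · simp [Pi.single_eq_of_ne hl]) hx
    rw [Submodule.mem_bot]
    refine Finset.sum_eq_zero fun l _ => ?_
    have := hw l
    rw [hbot, Submodule.mem_bot] at this
    rw [this, smul_zero]

/-- Take `c` above all degrees occurring in a finite set of generators of `R'(F)` over `R'(I)`.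
Generators satisfy the bound since `I^{n - c} = R` for `n ≤ c`, and `R'(I)`-linear combinations
preserve it. -/
theorem exists_ideal_le_idealPow_sub (hF : F.IsAdmissible) :
    ∃ c : Fin s → ℤ, ∀ n, F.ideal n ≤ idealPow I (n - c) := by
  let := (Subalgebra.inclusion F.adic_extRees_le).toRingHom.toAlgebra
  obtain ⟨S, hS⟩ : (⊤ : Submodule (adic I).extRees F.extRees).FG := hF.2.1
  obtain ⟨c, hc⟩ := ((Finset.finite_toSet S).biUnion fun g _ =>
    g.1.coeff.support.finite_toSet).bddAbove
  have key (x : F.extRees) : ∀ n, x.1.coeff n ∈ idealPow I (n - c) := by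
    induction (hS ▸ Submodule.mem_top : x ∈ Submodule.span (adic I).extRees (S : Set F.extRees))
      using Submodule.span_induction with
    | mem g hg =>
      intro n
      by_cases hgn : g.1.coeff n = 0
      · rw [hgn]
        exact zero_mem _
      · have hle : n ≤ c := hc (Set.mem_biUnion hg (Finsupp.mem_support_iff.2 hgn))
        refine idealPow_anti I (n - c) 0 (sub_nonpos.2 hle) ?_
        rw [idealPow_zero, Ideal.one_eq_top]
        trivial
    | zero => exact fun n => zero_mem _
    | add x y _ _ hx hy => exact fun n => add_mem (hx n) (hy n)
    | smul a x _ hx =>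
      classical
      intro n
      change (a.1 * x.1).coeff n ∈ _
      rw [AddMonoidAlgebra.coeff_mul]
      refine Ideal.sum_mem _ fun p _ => Ideal.sum_mem _ fun q _ => ?_
      dsimp only
      split_ifs with h
      · rw [← h, add_sub_assoc]
        exact idealPow_mul_le I p (q - c) (Ideal.mul_mem_mul (a.2 p) (hx q))
      · exact zero_mem _
  refine ⟨c, fun n a ha => ?_⟩
  have := key ⟨AddMonoidAlgebra.single n a, fun k => by
    classical
    rw [AddMonoidAlgebra.coeff_single, Finsupp.single_apply]
    split_ifs with hk
    · exact hk ▸ ha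
    · exact zero_mem _⟩ n
  classical
  simpa [AddMonoidAlgebra.coeff_single, Finsupp.single_apply] using this

/-- If `G(F)` vanishes in all degrees `≥ m` and some `I_j` lies in the maximal ideal, then `F(n) = 0`
for `n` large. -/
theorem ideal_eq_bot_of_assocPiece_eq_bot [IsLocalRing R] [IsNoetherianRing R]
    (hF : F.IsAdmissible) {m N : Fin s → ℤ} (hm : ∀ k, m ≤ k → F.assocPiece k = ⊥) (hN : 0 ≤ N)
    (hmN : m ≤ N) {j : Fin s} (hI : I j ≤ IsLocalRing.maximalIdeal R) : F.ideal N = ⊥ := by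
  obtain ⟨c, hc⟩ := F.exists_ideal_le_idealPow_sub hF
  have hstep (t : ℕ) : F.ideal N ≤ F.ideal (N + t • 1) := by
    induction t with
    | zero => simp
    | succ t ih =>
      have h1 : N ≤ N + t • 1 := le_add_of_nonneg_right (nsmul_nonneg zero_le_one t)
      rw [succ_nsmul, ← add_assoc]
      exact ih.trans (F.ideal_le_of_assocPiece_eq_bot (hN.trans h1) (hm _ (hmN.trans h1)))
  rw [eq_bot_iff, ← Ideal.iInf_pow_eq_bot_of_isLocalRing (IsLocalRing.maximalIdeal R)
    Ideal.IsPrime.ne_top']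
  refine le_iInf fun t => ?_
  -- The extra `(c j).toNat` steps absorb the shift by `c`: with `N j ≥ 0` the exponent of `I j` is
  -- at least `t`.
  refine (hstep (t + (c j).toNat)).trans ((hc _).trans ?_)
  rw [idealPow]
  refine (Ideal.prod_le_inf.trans (Finset.inf_le (Finset.mem_univ j))).trans ?_
  refine (Ideal.pow_right_mono hI _).trans (Ideal.pow_le_pow_right ?_)
  have := hN j
  simp only [Pi.sub_apply, Pi.add_apply, Pi.smul_apply, Pi.one_apply, Pi.zero_apply] at this ⊢
  simp only [nsmul_eq_mul, mul_one, Nat.cast_add]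
  omega

end MultiFiltration

/-! ### The dimension contradiction and the main theorem. -/

theorem ringKrullDim_le_zero_of_idealPow_eq_bot [IsLocalRing R]
    (hI : ∀ j, (I j).radical = IsLocalRing.maximalIdeal R) {n : Fin s → ℤ}
    (h : idealPow I n = ⊥) : ringKrullDim R ≤ 0 := by
  -- Every prime contains the zero product `I^n`, hence some `I_j`, hence the maximal ideal.
  have : Ring.KrullDimLE 0 R := Ring.krullDimLE_zero_iff.2 fun p hp => by
    have h1 : idealPow I n ≤ p := h ▸ bot_le
    obtain ⟨j, _, hj⟩ := (Ideal.IsPrime.prod_le hp).1 h1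
    have h2 : IsLocalRing.maximalIdeal R ≤ p := by
      rw [← hI j]
      exact hp.radical_le_iff.2 (Ideal.IsPrime.le_of_pow_le hj)
    exact (IsLocalRing.maximalIdeal.isMaximal R).eq_of_le hp.ne_top h2 ▸
      IsLocalRing.maximalIdeal.isMaximal R
  exact (Ring.krullDimLE_iff (n := 0)).1 this

end

end MultigradedRegularity

theorem theorem3p2 {R : Type*} [CommRing R] [IsLocalRing R] [IsNoetherianRing R]
    [Infinite (IsLocalRing.ResidueField R)] (hdim : 1 ≤ ringKrullDim R)
    {s : ℕ} (hs : 1 ≤ s) (I : Fin s → Ideal R)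
    (hI : ∀ j, (I j).IsPrimary ∧ (I j).radical = IsLocalRing.maximalIdeal R)
    (F : MultigradedRegularity.MultiFiltration I) (hF : F.IsAdmissible) :
    F.regAssoc ⊆ {m : Fin s → ℤ | ∀ j, 0 ≤ m j} := by
  intro m hm j
  by_contra! hj
  have hbot := F.ideal_eq_bot_of_assocPiece_eq_bot hF (N := m ⊔ 0) (j := j)
    (fun k hk => F.assocPiece_eq_bot_of_mem_regAssoc hm hj hk) le_sup_right le_sup_left
    (Ideal.le_radical.trans (hI j).2.le)
  have h0 := MultigradedRegularity.ringKrullDim_le_zero_of_idealPow_eq_bot (fun j => (hI j).2)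
    (le_bot_iff.1 ((F.idealPow_le _).trans hbot.le))
  exact absurd (hdim.trans h0) (by norm_num)
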